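/- Let $n\ge 1$ be an integer, $\alpha\in(1,2]$, $q\in[1,\infty)$ and $k>q(1+\alpha/n)$. Let $\phi_0>\alpha^{1/(k-1)}$, put $\phi_{i+1}=\phi_i^k$ for $i\ge 0$, and define $f:[0,\infty)\to[0,\infty)$ by $f(s)=(1-\phi_0^{1-k})s^k$ for $s\in[0,\phi_0]$ and, for every $i\ge1$, by $f(s)=\phi_i-\phi_{i-1}$ for $s\in(\phi_{i-1},\phi_i/\alpha]$, while on $(\phi_i/\alpha,\phi_i]$ the function $f$ interpolates linearly between its values $\phi_i-\phi_{i-1}$ at $\phi_i/\alpha$ and $\phi_{i+1}-\phi_i$ at $\phi_i$. Then $f$ is locally Lipschitz continuous and non-decreasing on $[0,\infty)$, $f(0)=0$, $f>0$ on $(0,\infty)$, and $f$ satisfies the Osgood condition $\int_1^\infty \frac{ds}{f(s)}=\infty$. For $t>0$ let $p(t,x,y)=(2\pi)^{-n}\int_{\mathbb R^n}e^{i(x-y)\cdot\xi}e^{-t|\xi|^\alpha}\,d\xi$ be the heat kernel of $\Delta^{\alpha/2}:=-(-\Delta)^{\alpha/2}$ on $\mathbb R^n$, and let $(S_\alpha(t)g)(x)=\int_{\mathbb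 R^n}p(t,x,y)g(y)\,dy$ for measurable $g\ge0$. For $u_0\ge 0$ and $T>0$, a local integral solution on $[0,T)$ of $$u_t=\Delta^{\alpha/2}u+f(u),\qquad u(0)=u_0,$$ is a measurable function $u:\mathbb R^n\times[0,T)\to[0,\infty]$, finite almost everywhere, such that $$u(t)=S_\alpha(t)u_0+\int_0^tS_\alpha(t-s)f(u(s))\,ds$$ holds almost everywhere on $\mathbb R^n\times[0,T)$. There is a non-negative $u_0\in L^q(\mathbb R^n)$ such that, for every $T>0$, this problem has no local integral solution $u$ on $[0,T)$ with $u(t)\in L^1_{\rm loc}(\mathbb R^n)$ for almost every $t\in[0,T)$. More precisely, the interval $\left(\frac{n+\alpha}{k},\frac nq\right)$ is non-empty, and for every $\beta$ in it and every $R>1$ the function $u_0(x)=|x|^{-\beta}$ for $|x|\le R$, $u_0(x)=0$ for $|x|>R$, has these properties. In particular, the Osgood condition does not guarantee the existence of local solutions for singular initial data. -/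

import Mathlib

open MeasureTheory Set
open scoped ENNReal

noncomputable section

namespace FracHeat

/-- The heat kernel `p(t,x,y)` of `Δ^{α/2} = -(-Δ)^{α/2}` on `ℝⁿ`, where `(-Δ)^{α/2}` is the
Fourier multiplier with symbol `|ξ|^α`:
`p(t,x,y) = (2π)⁻ⁿ ∫ exp(i (x-y)·ξ) exp(-t|ξ|^α) dξ` for `t > 0`.
The integral is real, so taking the real part only changes the type. -/
def heatKernel {n : ℕ} (α t : ℝ) (x y : EuclideanSpace ℝ (Fin n)) : ℝ :=
  ((2 * Real.pi) ^ n)⁻¹ *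
    (∫ ξ : EuclideanSpace ℝ (Fin n),
      Complex.exp (Complex.I * (inner ℝ (x - y) ξ : ℝ)) * Real.exp (-t * ‖ξ‖ ^ α)).re

/-- `(S_α(t) g)(x) = ∫ p(t,x,y) g(y) dy` for non-negative `g`, with values in `[0,∞]`. -/
def semigroup {n : ℕ} (α t : ℝ) (g : EuclideanSpace ℝ (Fin n) → ℝ≥0∞)
    (x : EuclideanSpace ℝ (Fin n)) : ℝ≥0∞ :=
  ∫⁻ y, ENNReal.ofReal (heatKernel α t x y) * g y

/-- `u : ℝⁿ × [0,T) → [0,∞]` is a local integral solution of `u_t = Δ^{α/2} u + f(u)`,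
`u(0) = u₀` on `[0,T)`: it is (Lebesgue) measurable, finite almost everywhere, and
`u(t) = S_α(t) u₀ + ∫_0^t S_α(t-s) f(u(s)) ds` holds almost everywhere on `ℝⁿ × [0,T)`.
Only the values of `u` on `ℝⁿ × [0,T)` and those of `f` on `[0,∞)` matter. -/
structure IsLocalIntegralSolution {n : ℕ} (α : ℝ) (f : ℝ → ℝ)
    (u₀ : EuclideanSpace ℝ (Fin n) → ℝ) (T : ℝ)
    (u : EuclideanSpace ℝ (Fin n) × ℝ → ℝ≥0∞) : Prop where
  aemeasurable : AEMeasurable u (volume.restrict (univ ×ˢ Ico 0 T))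
  finite_ae : ∀ᵐ z ∂(volume.restrict (univ ×ˢ Ico 0 T)), u z < ∞
  equation : ∀ᵐ z ∂(volume.restrict (univ ×ˢ Ico 0 T)),
    u z = semigroup α z.2 (fun y => ENNReal.ofReal (u₀ y)) z.1 +
      ∫⁻ s in Ioo 0 z.2,
        semigroup α (z.2 - s) (fun y => ENNReal.ofReal (f (u (y, s)).toReal)) z.1

/-- Membership of a non-negative function in `L¹_loc(ℝⁿ)`. -/
def MemL1Loc {n : ℕ} (g : EuclideanSpace ℝ (Fin n) → ℝ≥0∞) : Prop :=
  AEMeasurable g volume ∧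
    ∀ K : Set (EuclideanSpace ℝ (Fin n)), IsCompact K → ∫⁻ x in K, g x < ∞

/-- The standing conditions on a source term `f : [0,∞) → [0,∞)`: locally Lipschitz,
non-decreasing, `f(0) = 0` and `f > 0` on `(0,∞)`. -/
structure IsSource (f : ℝ → ℝ) : Prop where
  locallyLipschitz : LocallyLipschitzOn (Ici 0) f
  monotone : MonotoneOn f (Ici 0)
  zero : f 0 = 0
  pos : ∀ s, 0 < s → 0 < f s

/-- The Osgood condition `∫_1^∞ ds / f(s) = ∞`. -/
def Osgood (f : ℝ → ℝ) : Prop :=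
  ∫⁻ s in Ici (1 : ℝ), (ENNReal.ofReal (f s))⁻¹ = ∞

/-- The sequence `φ_0 = φ₀`, `φ_{i+1} = φ_i ^ k`. -/
def phi (k φ₀ : ℝ) : ℕ → ℝ
  | 0 => φ₀
  | i + 1 => phi k φ₀ i ^ k

/-- The explicit source term:
* `f(s) = (1 - φ_0^{1-k}) s^k` on `[0, φ_0]`;
* `f(s) = φ_i - φ_{i-1}` on `(φ_{i-1}, φ_i/α]`, `i ≥ 1`;
* on `(φ_i/α, φ_i]`, `i ≥ 1`, `f` is the linear interpolation between its values
  `φ_i - φ_{i-1}` at `φ_i/α` and `φ_{i+1} - φ_i` at `φ_i`.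

Below, for `s > φ_0`, `i = j + 1` is the index with `φ_{i-1} < s ≤ φ_i`. -/
def source (α k φ₀ : ℝ) (s : ℝ) : ℝ :=
  if s ≤ φ₀ then (1 - φ₀ ^ (1 - k)) * s ^ k
  else
    let j := sInf {j : ℕ | s ≤ phi k φ₀ (j + 1)}
    let a := phi k φ₀ j
    let b := phi k φ₀ (j + 1)
    let c := phi k φ₀ (j + 2)
    if s ≤ b / α then b - a
    else (b - a) + (s - b / α) / (b - b / α) * ((c - b) - (b - a))

/-- The initial value `u₀(x) = |x|^{-β}` for `|x| ≤ R`, and `0` for `|x| > R`. -/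
def initialValue {n : ℕ} (β R : ℝ) (x : EuclideanSpace ℝ (Fin n)) : ℝ :=
  if ‖x‖ ≤ R then ‖x‖ ^ (-β) else 0

end FracHeat

end

/-! The Osgood integral and the blow-up see different parts of `f`. On the plateau `(φ_i,
φ_{i+1}/α]` the source is constant, and the plateau's length divided by its height is at least `1/α
- φ₀^(1-k) > 0`; infinitely many disjoint plateaus make `∫ 1/f` diverge (`osgood_source`). At the
points `φ_i`, however, `f` is as large as a multiple of `φ_i^k` (`mul_rpow_le_source_phi`), and
monotonicity carries this value to every larger argument.

A kernel bound near the diagonal (`exists_le_heatKernel`) shows that `S_α(s)u₀` is at least of order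
`s^(-β/α)` on a ball of radius of order `s^(1/α)`. Hence a solution exceeds `φ_i` there up to a time
`σ_i ~ φ_i^(-α/β)`, and `f(u) ≥ C φ_i^k`. Integrating over `s ∈ (σ_i/2, σ_i)` in the equation at a
fixed later time, near the origin, gives `u ≥ M φ_i^k σ_i^(1+n/α) ~ φ_i^(k-(n+α)/β)`. This tends to
infinity when `β > (n+α)/k`, contradicting finiteness almost everywhere
(`not_isLocalIntegralSolution`). The condition `β < n/q` puts `u₀` in `L^q`. -/

noncomputable section

namespace FracHeat

/-! ### The source term: regularity, growth along `φ_i`, Osgood condition. -/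

section Phi

variable {α k φ₀ : ℝ}

lemma phi_succ (k φ₀ : ℝ) (i : ℕ) : phi k φ₀ (i + 1) = phi k φ₀ i ^ k := rfl

lemma one_lt_phi (hk : 1 < k) (h1 : 1 < φ₀) (i : ℕ) : 1 < phi k φ₀ i := by
  induction i with
  | zero => exact h1
  | succ i ih => exact Real.one_lt_rpow ih (by linarith)

lemma phi_pos (hk : 1 < k) (h1 : 1 < φ₀) (i : ℕ) : 0 < phi k φ₀ i :=
  zero_lt_one.trans (one_lt_phi hk h1 i)

lemma phi_lt_succ (hk : 1 < k) (h1 : 1 < φ₀) (i : ℕ) : phi k φ₀ i < phi k φ₀ (i + 1) := by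
  have := Real.rpow_lt_rpow_of_exponent_lt (one_lt_phi hk h1 i) hk
  rwa [Real.rpow_one] at this

lemma strictMono_phi (hk : 1 < k) (h1 : 1 < φ₀) : StrictMono (phi k φ₀) :=
  strictMono_nat_of_lt_succ (phi_lt_succ hk h1)

lemma le_phi (hk : 1 < k) (h1 : 1 < φ₀) (i : ℕ) : φ₀ ≤ phi k φ₀ i :=
  (strictMono_phi hk h1).monotone (Nat.zero_le i)

lemma mul_rpow_sub_one {a : ℝ} (ha : 0 < a) (k : ℝ) : a * a ^ (k - 1) = a ^ k := by
  rw [Real.rpow_sub_one ha.ne']; field_simp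

lemma mul_phi_lt_succ (hk : 1 < k) (h1 : 1 < φ₀) (hα : α < φ₀ ^ (k - 1)) (i : ℕ) :
    α * phi k φ₀ i < phi k φ₀ (i + 1) := by
  have hp := phi_pos hk h1 i
  rw [phi_succ, ← mul_rpow_sub_one hp, mul_comm]
  refine mul_lt_mul_of_pos_left (hα.trans_le ?_) hp
  exact Real.rpow_le_rpow (by linarith) (le_phi hk h1 i) (by linarith)

lemma tendsto_phi (hk : 1 < k) (h1 : 1 < φ₀) :
    Filter.Tendsto (phi k φ₀) Filter.atTop Filter.atTop := by
  have hb : 1 < φ₀ ^ (k - 1) := Real.one_lt_rpow h1 (by linarith)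
  -- Any ratio `1 < a < φ₀^(k-1)` gives a geometric minorant of `φ_i`.
  obtain ⟨a, ha, ha'⟩ := exists_between hb
  have key : ∀ i, a ^ i ≤ phi k φ₀ i := by
    intro i
    induction i with
    | zero => simpa [phi] using h1.le
    | succ i ih =>
      rw [pow_succ, mul_comm]
      exact (mul_le_mul_of_nonneg_left ih (by linarith)).trans (mul_phi_lt_succ hk h1 ha' i).le
  exact Filter.tendsto_atTop_mono key (tendsto_pow_atTop_atTop_of_one_lt ha)

/-- The slope of the source term on `(φ_{j+1}/α, φ_{j+1}]`. -/
def slope (α k φ₀ : ℝ) (j : ℕ) : ℝ :=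
  ((phi k φ₀ (j + 2) - phi k φ₀ (j + 1)) - (phi k φ₀ (j + 1) - phi k φ₀ j)) /
    (phi k φ₀ (j + 1) - phi k φ₀ (j + 1) / α)

lemma slope_denom_pos (hα1 : 1 < α) (hk : 1 < k) (h1 : 1 < φ₀) (j : ℕ) :
    0 < phi k φ₀ (j + 1) - phi k φ₀ (j + 1) / α :=
  sub_pos.2 (div_lt_self (phi_pos hk h1 _) hα1)

/-- The ratios `φ_{j+1}/φ_j = φ_j^(k-1)` exceed 1 and increase with `j`, so the increments grow;
this makes the ramps of `f` non-decreasing. -/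
lemma phi_sub_le (hk : 1 < k) (h1 : 1 < φ₀) (j : ℕ) :
    phi k φ₀ (j + 1) - phi k φ₀ j ≤ phi k φ₀ (j + 2) - phi k φ₀ (j + 1) := by
  have ha := one_lt_phi hk h1 j
  have hb := one_lt_phi hk h1 (j + 1)
  have hab := (phi_lt_succ hk h1 j).le
  have e1 : phi k φ₀ (j + 1) = phi k φ₀ j * phi k φ₀ j ^ (k - 1) := by
    rw [mul_rpow_sub_one (by linarith), phi_succ]
  have e2 : phi k φ₀ (j + 2) = phi k φ₀ (j + 1) * phi k φ₀ (j + 1) ^ (k - 1) := by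
    rw [mul_rpow_sub_one (by linarith), ← phi_succ]
  have h3 : phi k φ₀ j ^ (k - 1) ≤ phi k φ₀ (j + 1) ^ (k - 1) :=
    Real.rpow_le_rpow (by linarith) hab (by linarith)
  have h4 : 1 ≤ phi k φ₀ j ^ (k - 1) := Real.one_le_rpow ha.le (by linarith)
  rw [e2]
  nlinarith [mul_nonneg (sub_nonneg.2 hab) (sub_nonneg.2 h4),
    mul_nonneg (by linarith : (0 : ℝ) ≤ phi k φ₀ (j + 1)) (sub_nonneg.2 h3)]

lemma slope_nonneg (hα1 : 1 < α) (hk : 1 < k) (h1 : 1 < φ₀) (j : ℕ) : 0 ≤ slope α k φ₀ j :=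
  div_nonneg (sub_nonneg.2 (phi_sub_le hk h1 j)) (slope_denom_pos hα1 hk h1 j).le

lemma source_of_le {s : ℝ} (hs : s ≤ φ₀) : source α k φ₀ s = (1 - φ₀ ^ (1 - k)) * s ^ k :=
  if_pos hs

lemma source_of_mem (hk : 1 < k) (h1 : 1 < φ₀) {j : ℕ} {s : ℝ}
    (h : phi k φ₀ j < s) (h' : s ≤ phi k φ₀ (j + 1)) :
    source α k φ₀ s = (phi k φ₀ (j + 1) - phi k φ₀ j) +
      slope α k φ₀ j * max 0 (s - phi k φ₀ (j + 1) / α) := by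
  have hs : ¬ s ≤ φ₀ := not_le.2 ((le_phi hk h1 j).trans_lt h)
  have hj : sInf {j : ℕ | s ≤ phi k φ₀ (j + 1)} = j := by
    refine le_antisymm (Nat.sInf_le h') (le_csInf ⟨j, h'⟩ fun m hm => ?_)
    by_contra! hlt
    exact absurd (hm.trans ((strictMono_phi hk h1).monotone (Nat.succ_le_of_lt hlt))) (not_le.2 h)
  simp only [source, if_neg hs, hj]
  split_ifs with hb
  · rw [max_eq_left (by linarith)]; ring
  · rw [max_eq_right (by linarith), slope]; ring

/-- A globally Lipschitz monotone function that agrees with the source term on `[0, φ_N]`. -/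
def sourceTrunc (α k φ₀ : ℝ) : ℕ → ℝ → ℝ
  | 0, s => (1 - φ₀ ^ (1 - k)) * (min s φ₀) ^ k
  | N + 1, s => sourceTrunc α k φ₀ N s +
      slope α k φ₀ N * max 0 (min s (phi k φ₀ (N + 1)) - phi k φ₀ (N + 1) / α)

lemma one_sub_rpow_pos (hk : 1 < k) (h1 : 1 < φ₀) : 0 < 1 - φ₀ ^ (1 - k) :=
  sub_pos.2 (Real.rpow_lt_one_of_one_lt_of_neg h1 (by linarith))

lemma phi_succ_sub (hk : 1 < k) (h1 : 1 < φ₀) (i : ℕ) :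
    phi k φ₀ (i + 1) - phi k φ₀ i = (1 - phi k φ₀ i ^ (1 - k)) * phi k φ₀ i ^ k := by
  have hp := phi_pos hk h1 i
  rw [sub_mul, ← Real.rpow_add hp, phi_succ]
  norm_num

/-- Past `φ_N` every ramp is saturated, and a saturated ramp adds exactly a second difference of
`φ`, so the sum telescopes. -/
lemma sourceTrunc_of_ge (hα1 : 1 < α) (hk : 1 < k) (h1 : 1 < φ₀) (N : ℕ) {s : ℝ}
    (hs : phi k φ₀ N ≤ s) :
    sourceTrunc α k φ₀ N s = phi k φ₀ (N + 1) - phi k φ₀ N := by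
  induction N with
  | zero =>
    rw [phi_succ_sub hk h1, sourceTrunc, min_eq_right (show φ₀ ≤ s from hs)]; rfl
  | succ N ih =>
    have hd := slope_denom_pos hα1 hk h1 N
    rw [sourceTrunc, ih ((phi_lt_succ hk h1 N).le.trans hs), min_eq_right hs,
      max_eq_right hd.le, slope, div_mul_cancel₀ _ hd.ne']
    ring

/-- The new ramp starts at `φ_{N+1}/α`, which lies beyond `φ_N` because `α < φ₀^(k-1)`; it leaves
the earlier values unchanged. -/
lemma source_eq_sourceTrunc (hα1 : 1 < α) (hk : 1 < k) (h1 : 1 < φ₀) (hα : α < φ₀ ^ (k - 1))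
    (N : ℕ) {s : ℝ} (hs : s ≤ phi k φ₀ N) : source α k φ₀ s = sourceTrunc α k φ₀ N s := by
  induction N with
  | zero => rw [source_of_le (show s ≤ φ₀ from hs), sourceTrunc, min_eq_left (show s ≤ φ₀ from hs)]
  | succ N ih =>
    rcases le_or_gt s (phi k φ₀ N) with h | h
    · have h2 : phi k φ₀ N < phi k φ₀ (N + 1) / α := by
        rw [lt_div_iff₀ (by linarith), mul_comm]; exact mul_phi_lt_succ hk h1 hα N
      rw [ih h, sourceTrunc, min_eq_left hs, max_eq_left (by linarith)]
      ring
    · rw [source_of_mem hk h1 h hs, sourceTrunc, sourceTrunc_of_ge hα1 hk h1 N h.le,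
        min_eq_left hs]

lemma monotoneOn_sourceTrunc (hα1 : 1 < α) (hk : 1 < k) (h1 : 1 < φ₀) (N : ℕ) :
    MonotoneOn (sourceTrunc α k φ₀ N) (Ici 0) := by
  induction N with
  | zero =>
    intro s hs t _ hst
    refine mul_le_mul_of_nonneg_left ?_ (one_sub_rpow_pos hk h1).le
    exact Real.rpow_le_rpow (le_min hs (by linarith)) (min_le_min_right _ hst) (by linarith)
  | succ N ih =>
    intro s hs t ht hst
    refine add_le_add (ih hs ht hst) (mul_le_mul_of_nonneg_left ?_ (slope_nonneg hα1 hk h1 N))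
    exact max_le_max_left _ (sub_le_sub_right (min_le_min_right _ hst) _)

lemma exists_lipschitzOnWith_sourceTrunc (hk : 1 < k) (h1 : 1 < φ₀) (N : ℕ) :
    ∃ K, LipschitzOnWith K (sourceTrunc α k φ₀ N) (Ici 0) := by
  induction N with
  | zero =>
    have hc : ContDiffOn ℝ 1 (fun x : ℝ => x ^ k) (Icc 0 φ₀) :=
      (Real.contDiff_rpow_const_of_le (n := 1) (by exact_mod_cast hk.le)).contDiffOn
    obtain ⟨K, hK⟩ := hc.exists_lipschitzOnWith one_ne_zero (convex_Icc 0 φ₀) isCompact_Icc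
    have hm : LipschitzOnWith 1 (fun s : ℝ => min s φ₀) (Ici 0) :=
      (LipschitzWith.id.min_const φ₀).lipschitzOnWith
    have h := hK.comp hm fun s (hs : 0 ≤ s) => ⟨le_min hs (by linarith), min_le_right _ _⟩
    exact ⟨_, ((lipschitzWith_smul (1 - φ₀ ^ (1 - k))).comp_lipschitzOnWith h)⟩
  | succ N ih =>
    obtain ⟨K, hK⟩ := ih
    have h : LipschitzWith 1 fun s : ℝ =>
        max 0 (min s (phi k φ₀ (N + 1)) - phi k φ₀ (N + 1) / α) := by
      have h2 := ((LipschitzWith.id.min_const (phi k φ₀ (N + 1))).sub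
        (LipschitzWith.const (phi k φ₀ (N + 1) / α))).const_max (0 : ℝ)
      simpa using h2
    exact ⟨_, hK.add ((lipschitzWith_smul (slope α k φ₀ N)).comp h).lipschitzOnWith⟩

lemma exists_le_phi (hk : 1 < k) (h1 : 1 < φ₀) (s : ℝ) : ∃ N, s < phi k φ₀ N :=
  ((tendsto_phi hk h1).eventually (Filter.eventually_gt_atTop s)).exists

theorem isSource_source (hα1 : 1 < α) (hk : 1 < k) (h1 : 1 < φ₀) (hα : α < φ₀ ^ (k - 1)) :
    IsSource (source α k φ₀) where
  locallyLipschitz := by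
    intro x _
    obtain ⟨N, hN⟩ := exists_le_phi hk h1 x
    obtain ⟨K, hK⟩ := exists_lipschitzOnWith_sourceTrunc (α := α) hk h1 N
    refine ⟨K, Ici 0 ∩ Iio (phi k φ₀ N), inter_mem_nhdsWithin _ (Iio_mem_nhds hN), ?_⟩
    intro y hy z hz
    rw [source_eq_sourceTrunc hα1 hk h1 hα N (le_of_lt hy.2),
      source_eq_sourceTrunc hα1 hk h1 hα N (le_of_lt hz.2)]
    exact hK hy.1 hz.1
  monotone := by
    intro s hs t ht hst
    obtain ⟨N, hN⟩ := exists_le_phi hk h1 t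
    rw [source_eq_sourceTrunc hα1 hk h1 hα N hN.le,
      source_eq_sourceTrunc hα1 hk h1 hα N (hst.trans hN.le)]
    exact monotoneOn_sourceTrunc hα1 hk h1 N hs ht hst
  zero := by
    rw [source_of_le (by linarith), Real.zero_rpow (by linarith), mul_zero]
  pos := by
    intro s hs
    rcases le_or_gt s φ₀ with h | h
    · rw [source_of_le h]
      exact mul_pos (one_sub_rpow_pos hk h1) (Real.rpow_pos_of_pos hs _)
    · obtain ⟨N, hN⟩ := exists_le_phi hk h1 s
      have h0 : ∀ M, φ₀ ^ k - φ₀ ≤ sourceTrunc α k φ₀ M s := by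
        intro M
        induction M with
        | zero => exact (sourceTrunc_of_ge (N := 0) hα1 hk h1 h.le).ge
        | succ M ih =>
          exact ih.trans (le_add_of_nonneg_right
            (mul_nonneg (slope_nonneg hα1 hk h1 M) (le_max_left _ _)))
      rw [source_eq_sourceTrunc hα1 hk h1 hα N hN.le]
      exact (sub_pos.2 (phi_lt_succ hk h1 0)).trans_le (h0 N)

lemma source_phi (hα1 : 1 < α) (hk : 1 < k) (h1 : 1 < φ₀) (hα : α < φ₀ ^ (k - 1)) (i : ℕ) :
    source α k φ₀ (phi k φ₀ i) = phi k φ₀ (i + 1) - phi k φ₀ i := by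
  rw [source_eq_sourceTrunc hα1 hk h1 hα i le_rfl, sourceTrunc_of_ge hα1 hk h1 i le_rfl]

/-- The factor `1 - φ_i^(1-k)` is smallest at `i = 0`. This power growth along a sequence drives the
nonexistence. -/
lemma mul_rpow_le_source_phi (hα1 : 1 < α) (hk : 1 < k) (h1 : 1 < φ₀) (hα : α < φ₀ ^ (k - 1))
    (i : ℕ) : (1 - φ₀ ^ (1 - k)) * phi k φ₀ i ^ k ≤ source α k φ₀ (phi k φ₀ i) := by
  rw [source_phi hα1 hk h1 hα, phi_succ_sub hk h1]
  refine mul_le_mul_of_nonneg_right (sub_le_sub_left ?_ _) (Real.rpow_nonneg (phi_pos hk h1 i).le _)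
  exact Real.rpow_le_rpow_of_nonpos (by linarith) (le_phi hk h1 i) (by linarith)

theorem osgood_source (hα1 : 1 < α) (hk : 1 < k) (h1 : 1 < φ₀) (hα : α < φ₀ ^ (k - 1)) :
    Osgood (source α k φ₀) := by
  have hα0 : 0 < α := by linarith
  set I : ℕ → Set ℝ := fun i => Ioc (phi k φ₀ i) (phi k φ₀ (i + 1) / α) with hI
  have hdiv : ∀ i, phi k φ₀ (i + 1) / α ≤ phi k φ₀ (i + 1) := fun i =>
    (div_lt_self (phi_pos hk h1 _) hα1).le
  have hdisj : Pairwise (Function.onFun Disjoint I) := by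
    refine (pairwise_disjoint_on I).2 fun i j hij => ?_
    refine Set.disjoint_left.2 fun x hx hx' => ?_
    have := (strictMono_phi hk h1).monotone (Nat.succ_le_of_lt hij)
    have h2 := hx'.1
    have h3 := hx.2.trans (hdiv i)
    simp only [Nat.succ_eq_add_one] at this
    linarith
  -- Lower bound for length over height of every plateau, from `φ_i/φ_{i+1} = φ_i^(1-k) ≤ φ₀^(1-k)`.
  set ε : ℝ := 1 / α - φ₀ ^ (1 - k) with hε
  have hε0 : 0 < ε := by
    have : φ₀ ^ (1 - k) = (φ₀ ^ (k - 1))⁻¹ := by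
      rw [← Real.rpow_neg (by linarith)]; congr 1; ring
    rw [hε, this, sub_pos, one_div]
    exact inv_strictAnti₀ hα0 hα
  have hpiece : ∀ i, ENNReal.ofReal ε ≤ ∫⁻ s in I i, (ENNReal.ofReal (source α k φ₀ s))⁻¹ := by
    intro i
    have hd : 0 < phi k φ₀ (i + 1) - phi k φ₀ i := sub_pos.2 (phi_lt_succ hk h1 i)
    have hp := phi_pos hk h1 i
    have hp' := phi_pos hk h1 (i + 1)
    have : ∀ s ∈ I i, (ENNReal.ofReal (source α k φ₀ s))⁻¹ =
        ENNReal.ofReal (phi k φ₀ (i + 1) - phi k φ₀ i)⁻¹ := by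
      intro s hs
      rw [source_of_mem hk h1 hs.1 (hs.2.trans (hdiv i)), max_eq_left (by linarith [hs.2]),
        mul_zero, add_zero, ENNReal.ofReal_inv_of_pos hd]
    rw [setLIntegral_congr_fun measurableSet_Ioc this, setLIntegral_const, Real.volume_Ioc,
      ← ENNReal.ofReal_mul (inv_nonneg.2 hd.le)]
    refine ENNReal.ofReal_le_ofReal ?_
    rw [inv_mul_eq_div, le_div_iff₀ hd]
    have e : phi k φ₀ i ≤ φ₀ ^ (1 - k) * phi k φ₀ (i + 1) := by
      have h2 : phi k φ₀ i = phi k φ₀ i ^ (1 - k) * phi k φ₀ (i + 1) := by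
        rw [phi_succ, ← Real.rpow_add hp]; norm_num
      calc phi k φ₀ i = phi k φ₀ i ^ (1 - k) * phi k φ₀ (i + 1) := h2
        _ ≤ _ := mul_le_mul_of_nonneg_right
          (Real.rpow_le_rpow_of_nonpos (by linarith) (le_phi hk h1 i) (by linarith)) hp'.le
    have : ε * (phi k φ₀ (i + 1) - phi k φ₀ i) ≤ ε * phi k φ₀ (i + 1) :=
      mul_le_mul_of_nonneg_left (by linarith) hε0.le
    have e2 : ε * phi k φ₀ (i + 1) = phi k φ₀ (i + 1) / α - φ₀ ^ (1 - k) * phi k φ₀ (i + 1) := by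
      rw [hε]; ring
    linarith
  have hsub : (⋃ i, I i) ⊆ Ici 1 := by
    refine iUnion_subset fun i s hs => ?_
    exact (one_lt_phi hk h1 i).le.trans hs.1.le
  refine top_unique ?_
  calc (∞ : ℝ≥0∞) = ∑' _ : ℕ, ENNReal.ofReal ε :=
        (ENNReal.tsum_const_eq_top_of_ne_zero (by simpa using hε0)).symm
    _ ≤ ∑' i, ∫⁻ s in I i, (ENNReal.ofReal (source α k φ₀ s))⁻¹ := ENNReal.tsum_le_tsum hpiece
    _ = ∫⁻ s in ⋃ i, I i, (ENNReal.ofReal (source α k φ₀ s))⁻¹ :=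
        (lintegral_iUnion (fun _ => measurableSet_Ioc) hdisj _).symm
    _ ≤ _ := lintegral_mono_set hsub

end Phi

/-! ### Lower bound for the heat kernel near the diagonal. -/

section Kernel

variable {n : ℕ}

local notation "E" => EuclideanSpace ℝ (Fin n)

lemma integrable_norm_pow_mul_exp_neg_mul_norm_rpow (hn : 0 < n) {α t : ℝ} (hα : 0 < α)
    (ht : 0 < t) (m : ℕ) :
    Integrable fun ξ : E => ‖ξ‖ ^ m * Real.exp (-t * ‖ξ‖ ^ α) := by
  have : Nontrivial E := by
    have : Nonempty (Fin n) := ⟨⟨0, hn⟩⟩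
    infer_instance
  refine (integrable_fun_norm_addHaar (volume : Measure E)
    (f := fun y => y ^ m * Real.exp (-t * y ^ α))).2 ?_
  have hs : (-1 : ℝ) < ((n - 1 + m : ℕ) : ℝ) := by
    have : (0 : ℝ) ≤ ((n - 1 + m : ℕ) : ℝ) := Nat.cast_nonneg _
    linarith
  refine (integrableOn_rpow_mul_exp_neg_mul_rpow hs hα ht).congr_fun ?_ measurableSet_Ioi
  intro y _
  simp only [Real.rpow_natCast, finrank_euclideanSpace, Fintype.card_fin, smul_eq_mul, pow_add,
    mul_assoc]

/-- Substitution `ξ ↦ t^(1/α) ξ`. -/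
lemma integral_norm_pow_mul_exp_scaling {α t : ℝ} (hα : 0 < α) (ht : 0 < t) (m : ℕ) :
    ∫ ξ : E, ‖ξ‖ ^ m * Real.exp (-t * ‖ξ‖ ^ α) =
      (t ^ (-(1 / α))) ^ (n + m) * ∫ ξ : E, ‖ξ‖ ^ m * Real.exp (-‖ξ‖ ^ α) := by
  set r : ℝ := t ^ (1 / α) with hr
  have hr0 : 0 < r := Real.rpow_pos_of_pos ht _
  have hrα : r ^ α = t := by
    rw [hr, ← Real.rpow_mul ht.le, one_div_mul_cancel hα.ne', Real.rpow_one]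
  have h := Measure.integral_comp_smul (volume : Measure E)
    (fun ξ => ‖ξ‖ ^ m * Real.exp (-‖ξ‖ ^ α)) r
  have h2 : ∀ ξ : E, ‖r • ξ‖ ^ m * Real.exp (-‖r • ξ‖ ^ α) =
      r ^ m * (‖ξ‖ ^ m * Real.exp (-t * ‖ξ‖ ^ α)) := by
    intro ξ
    rw [norm_smul, Real.norm_of_nonneg hr0.le, mul_pow, Real.mul_rpow hr0.le (norm_nonneg _), hrα,
      neg_mul]
    ring
  simp only [h2] at h
  rw [integral_const_mul, finrank_euclideanSpace, Fintype.card_fin, smul_eq_mul,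
    abs_of_pos (by positivity)] at h
  rw [Real.rpow_neg ht.le, ← hr, inv_pow, pow_add]
  field_simp
  field_simp at h
  linarith

lemma integral_exp_neg_norm_rpow_pos {α : ℝ} (hn : 0 < n) (hα : 0 < α) (m : ℕ) :
    0 < ∫ ξ : E, ‖ξ‖ ^ m * Real.exp (-‖ξ‖ ^ α) := by
  have hi := integrable_norm_pow_mul_exp_neg_mul_norm_rpow hn hα one_pos m
  simp only [neg_mul, one_mul] at hi
  have : Nontrivial E := by
    have : Nonempty (Fin n) := ⟨⟨0, hn⟩⟩
    infer_instance
  rw [integral_pos_iff_support_of_nonneg (fun ξ => by positivity) hi]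
  have hs : ({0}ᶜ : Set E) ⊆ Function.support fun ξ : E => ‖ξ‖ ^ m * Real.exp (-‖ξ‖ ^ α) := by
    intro ξ hξ
    have : 0 < ‖ξ‖ := norm_pos_iff.2 hξ
    exact (by positivity : (0 : ℝ) < ‖ξ‖ ^ m * Real.exp (-‖ξ‖ ^ α)).ne'
  refine lt_of_lt_of_le ?_ (measure_mono hs)
  exact isOpen_compl_singleton.measure_pos _ (exists_ne 0)

lemma heatKernel_eq_integral_cos (hn : 0 < n) {α t : ℝ} (hα : 0 < α) (ht : 0 < t) (x y : E) :
    heatKernel α t x y = ((2 * Real.pi) ^ n)⁻¹ *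
      ∫ ξ : E, Real.cos (inner ℝ (x - y) ξ) * Real.exp (-t * ‖ξ‖ ^ α) := by
  have hi : Integrable fun ξ : E =>
      Complex.exp (Complex.I * (inner ℝ (x - y) ξ : ℝ)) * Real.exp (-t * ‖ξ‖ ^ α) := by
    have h0 := integrable_norm_pow_mul_exp_neg_mul_norm_rpow hn hα ht 0
    simp only [pow_zero, one_mul] at h0
    refine h0.ofReal.bdd_mul (c := 1) (by fun_prop) (Filter.Eventually.of_forall fun ξ => ?_)
    rw [mul_comm, Complex.norm_exp_ofReal_mul_I]
  rw [heatKernel, ← RCLike.re_eq_complex_re, ← integral_re hi]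
  congr 2
  ext ξ
  rw [RCLike.re_eq_complex_re, Complex.re_mul_ofReal, mul_comm Complex.I,
    Complex.exp_ofReal_mul_I_re]

/-- The near-diagonal lower bound `p(t,x,y) ≥ c t^{-n/α}` for `|x - y| ≤ δ t^{1/α}`. -/
theorem exists_le_heatKernel (hn : 0 < n) {α : ℝ} (hα : 0 < α) :
    ∃ c > 0, ∃ δ > 0, ∀ t > 0, ∀ x y : E, ‖x - y‖ ≤ δ * t ^ (1 / α) →
      c * (t ^ (-(1 / α))) ^ n ≤ heatKernel α t x y := by
  set A := ∫ ξ : E, ‖ξ‖ ^ 0 * Real.exp (-‖ξ‖ ^ α) with hA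
  set B := ∫ ξ : E, ‖ξ‖ ^ 1 * Real.exp (-‖ξ‖ ^ α) with hB
  have hA0 : 0 < A := integral_exp_neg_norm_rpow_pos hn hα 0
  have hB0 : 0 < B := integral_exp_neg_norm_rpow_pos hn hα 1
  -- From `cos v ≥ 1 - |v|`, the loss is at most `‖x - y‖` times the first moment; `δ = A/(2B)`
  -- keeps it below half of the mass.
  refine ⟨((2 * Real.pi) ^ n)⁻¹ * (A / 2), by positivity, A / (2 * B), by positivity, ?_⟩
  intro t ht x y hxy
  rw [heatKernel_eq_integral_cos hn hα ht, mul_assoc]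
  refine mul_le_mul_of_nonneg_left ?_ (by positivity)
  have i0 := integrable_norm_pow_mul_exp_neg_mul_norm_rpow hn hα ht 0
  have i1 := integrable_norm_pow_mul_exp_neg_mul_norm_rpow hn hα ht 1
  have e0 := integral_norm_pow_mul_exp_scaling (n := n) hα ht 0
  have e1 := integral_norm_pow_mul_exp_scaling (n := n) hα ht 1
  rw [← hA] at e0
  rw [← hB] at e1
  set r := t ^ (1 / α) with hr
  have hr0 : 0 < r := Real.rpow_pos_of_pos ht _
  rw [Real.rpow_neg ht.le, ← hr] at e0 e1 ⊢
  have hmono : ∫ ξ : E, (‖ξ‖ ^ 0 * Real.exp (-t * ‖ξ‖ ^ α) -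
      ‖x - y‖ * (‖ξ‖ ^ 1 * Real.exp (-t * ‖ξ‖ ^ α))) ≤
      ∫ ξ : E, Real.cos (inner ℝ (x - y) ξ) * Real.exp (-t * ‖ξ‖ ^ α) := by
    refine integral_mono (i0.sub (i1.const_mul _)) ?_ fun ξ => ?_
    · simp only [pow_zero, one_mul] at i0
      refine i0.bdd_mul (c := 1) (by fun_prop) (Filter.Eventually.of_forall fun ξ => ?_)
      exact Real.abs_cos_le_one _
    · have h1 : |inner ℝ (x - y) ξ| ≤ ‖x - y‖ * ‖ξ‖ := abs_real_inner_le_norm _ _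
      have h2 : 1 - |inner ℝ (x - y) ξ| ≤ Real.cos (inner ℝ (x - y) ξ) := by
        rcases le_total |inner ℝ (x - y) ξ| 2 with h | h
        · have := Real.one_sub_sq_div_two_le_cos (x := inner ℝ (x - y) ξ)
          rw [← sq_abs] at this
          nlinarith [abs_nonneg (inner ℝ (x - y) ξ)]
        · linarith [Real.neg_one_le_cos (inner ℝ (x - y) ξ)]
      have h3 := mul_le_mul_of_nonneg_right (sub_le_sub_left h1 1 |>.trans h2)
        (Real.exp_pos (-t * ‖ξ‖ ^ α)).le
      simp only [pow_zero, pow_one]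
      linarith
  refine le_trans ?_ hmono
  rw [integral_sub i0 (i1.const_mul _), integral_const_mul, e0, e1, add_zero, pow_succ]
  have h4 : ‖x - y‖ * (r⁻¹ ^ n * r⁻¹ * B) ≤ A / (2 * B) * r * (r⁻¹ ^ n * r⁻¹ * B) :=
    mul_le_mul_of_nonneg_right hxy (by positivity)
  have h5 : A / (2 * B) * r * (r⁻¹ ^ n * r⁻¹ * B) = A / 2 * r⁻¹ ^ n := by
    field_simp
  linarith

end Kernel

/-! ### The singular initial value and nonexistence. -/

section Nonexistence

variable {n : ℕ}

local notation "E" => EuclideanSpace ℝ (Fin n)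

lemma initialValue_nonneg (β R : ℝ) (x : E) : 0 ≤ initialValue β R x := by
  unfold initialValue
  split_ifs <;> positivity

theorem memLp_initialValue (hn : 0 < n) {β q : ℝ} (hq : 0 < q) (hβ : β * q < n) (R : ℝ) :
    MemLp (initialValue β R : E → ℝ) (ENNReal.ofReal q) volume := by
  have : Nontrivial E := by
    have : Nonempty (Fin n) := ⟨⟨0, hn⟩⟩
    infer_instance
  have hm : Measurable (initialValue β R : E → ℝ) :=
    Measurable.ite (measurableSet_le measurable_norm measurable_const) (by fun_prop)
      measurable_const
  rw [← integrable_norm_rpow_iff hm.aestronglyMeasurable (by simpa using hq) (by simp),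
    ENNReal.toReal_ofReal hq.le]
  have he : (fun x : E => ‖initialValue β R x‖ ^ q) =
      fun x => (Iic R).indicator (fun y => y ^ (-β * q)) ‖x‖ := by
    ext x
    rw [Real.norm_of_nonneg (initialValue_nonneg β R x)]
    by_cases hx : ‖x‖ ≤ R
    · rw [initialValue, if_pos hx, indicator_of_mem (mem_Iic.2 hx), Real.rpow_mul (norm_nonneg _)]
    · simp [initialValue, hx, Real.zero_rpow hq.ne']
  rw [he, integrable_fun_norm_addHaar (volume : Measure E)
    (f := (Iic R).indicator fun y => y ^ (-β * q))]
  rcases le_or_gt R 0 with hR | hR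
  · refine integrableOn_zero.congr_fun (fun y hy => ?_) measurableSet_Ioi
    have : ¬ y ≤ R := not_le.2 (hR.trans_lt hy)
    simp [this]
  have h1 : IntegrableOn (fun y : ℝ => y ^ ((n : ℝ) - 1 + -β * q)) (Ioc 0 R) := by
    rw [integrableOn_Ioc_iff_integrableOn_Ioo, intervalIntegral.integrableOn_Ioo_rpow_iff hR]
    linarith
  have h2 := h1.integrable_indicator measurableSet_Ioc
  refine h2.integrableOn.congr_fun (fun y (hy : 0 < y) => ?_) measurableSet_Ioi
  by_cases hyR : y ≤ R
  · rw [indicator_of_mem (show y ∈ Ioc 0 R from ⟨hy, hyR⟩), Real.rpow_add hy,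
      finrank_euclideanSpace, Fintype.card_fin, ← Nat.cast_pred hn, Real.rpow_natCast]
    simp [hyR]
  · simp [hyR]

/-- A lower bound for the semigroup from a near-diagonal lower bound of the kernel. -/
lemma le_semigroup {α t a ρ m : ℝ} {g : E → ℝ≥0∞} {x : E} (hm : 0 ≤ m) (hρ : 0 < ρ)
    (ha : ∀ y ∈ Metric.ball (0 : E) ρ, a ≤ heatKernel α t x y)
    (hg : ∀ᵐ y, y ∈ Metric.ball (0 : E) ρ → ENNReal.ofReal m ≤ g y) :
    ENNReal.ofReal (a * m * (ρ ^ n * volume.real (Metric.ball (0 : E) 1))) ≤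
      semigroup α t g x := by
  have hv : volume (Metric.ball (0 : E) ρ) =
      ENNReal.ofReal (ρ ^ n * volume.real (Metric.ball (0 : E) 1)) := by
    rw [Measure.addHaar_ball_of_pos _ _ hρ, finrank_euclideanSpace, Fintype.card_fin,
      ENNReal.ofReal_mul (by positivity), ofReal_measureReal]
  calc ENNReal.ofReal (a * m * (ρ ^ n * volume.real (Metric.ball (0 : E) 1)))
      = ∫⁻ _ in Metric.ball (0 : E) ρ, ENNReal.ofReal a * ENNReal.ofReal m := by
        rw [setLIntegral_const, hv, ← ENNReal.ofReal_mul' hm, ← ENNReal.ofReal_mul' (by positivity)]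
    _ ≤ ∫⁻ y in Metric.ball (0 : E) ρ, ENNReal.ofReal (heatKernel α t x y) * g y := by
        refine lintegral_mono_ae ((ae_restrict_iff' measurableSet_ball).2 ?_)
        filter_upwards [hg] with y hy hmem
        exact mul_le_mul' (ENNReal.ofReal_le_ofReal (ha y hmem)) (hy hmem)
    _ ≤ _ := setLIntegral_le_lintegral _ _

/-- `S_α(s) u₀ ≥ C ρ^{-β}` on the ball of radius `ρ` comparable to `s^{1/α}`. -/
lemma exists_le_semigroup_initialValue {α c δ β R : ℝ} (hβ : 0 < β) (hR : 1 < R) (hδ : 0 < δ)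
    (hc : 0 < c) (hn : 0 < n)
    (hK : ∀ t > 0, ∀ x y : E, ‖x - y‖ ≤ δ * t ^ (1 / α) →
      c * (t ^ (-(1 / α))) ^ n ≤ heatKernel α t x y) :
    ∃ C > 0, ∀ s > 0, δ / 2 * s ^ (1 / α) ≤ 1 →
      ∀ y ∈ Metric.ball (0 : E) (δ / 2 * s ^ (1 / α)),
        ENNReal.ofReal (C * (δ / 2 * s ^ (1 / α)) ^ (-β)) ≤
          semigroup α s (fun z => ENNReal.ofReal (initialValue β R z)) y := by
  have hw : 0 < volume.real (Metric.ball (0 : E) 1) :=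
    ENNReal.toReal_pos (Metric.measure_ball_pos _ _ one_pos).ne' measure_ball_lt_top.ne
  refine ⟨c * (δ / 2) ^ n * volume.real (Metric.ball (0 : E) 1), by positivity, ?_⟩
  intro s hs hs1 y hy
  have hr : 0 < s ^ (1 / α) := Real.rpow_pos_of_pos hs _
  set ρ := δ / 2 * s ^ (1 / α) with hρ
  have hρ0 : 0 < ρ := by positivity
  refine le_trans (ENNReal.ofReal_le_ofReal (le_of_eq ?_))
    (le_semigroup (m := ρ ^ (-β)) (by positivity) hρ0
      (fun z hz => hK s hs y z ?_) ?_)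
  · rw [Real.rpow_neg hs.le, hρ, mul_pow, inv_pow]
    field_simp
  -- Two points of the ball of radius `ρ` are within `2ρ = δ s^(1/α)`, which is why `δ` is halved.
  · rw [mem_ball_zero_iff] at hy hz
    have := norm_sub_le y z
    linarith
  · have hne : ∀ᵐ z : E, z ≠ 0 := by
      have : Nontrivial E := by
        have : Nonempty (Fin n) := ⟨⟨0, hn⟩⟩
        infer_instance
      exact Measure.ae_ne _ _
    filter_upwards [hne] with z hz0 hz
    rw [mem_ball_zero_iff] at hz
    rw [initialValue, if_pos (by linarith)]
    exact ENNReal.ofReal_le_ofReal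
      (Real.rpow_le_rpow_of_nonpos (norm_pos_iff.2 hz0) hz.le (by linarith))

/-- Fubini with time as the outer variable, so that a good time can be fixed first. -/
lemma ae_ae_of_ae_restrict_univ_prod {T : ℝ} {p : E × ℝ → Prop}
    (h : ∀ᵐ z ∂((volume : Measure (E × ℝ)).restrict (univ ×ˢ Ico 0 T)), p z) :
    ∀ᵐ t ∂(volume.restrict (Ioo 0 T)), ∀ᵐ x : E, p (x, t) := by
  have h1 : ∀ᵐ z ∂((volume : Measure E).prod (volume.restrict (Ioo 0 T))), p z := by
    rw [← Measure.restrict_univ (μ := (volume : Measure E)), Measure.prod_restrict]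
    exact ae_restrict_of_ae_restrict_of_subset (prod_mono_right Ioo_subset_Ico_self) h
  have h2 := (Measure.measurePreserving_swap (μ := volume.restrict (Ioo 0 T))
    (ν := (volume : Measure E))).quasiMeasurePreserving.ae h1
  exact Measure.ae_ae_of_ae_prod h2

/-- No local integral solution exists if `f(φ_i) ≥ C φ_i^k` along some sequence `φ_i → ∞`
and `β > (n + α) / k`. -/
theorem not_isLocalIntegralSolution (hn : 0 < n) {α β R k C T : ℝ} {f : ℝ → ℝ} {φ : ℕ → ℝ}
    (hα : 0 < α) (hβ : 0 < β) (hR : 1 < R) (hk : (n + α) / β < k) (hC : 0 < C)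
    (hf : MonotoneOn f (Ici 0)) (hφ0 : ∀ i, 0 < φ i)
    (hφ : Filter.Tendsto φ Filter.atTop Filter.atTop) (hfφ : ∀ i, C * φ i ^ k ≤ f (φ i))
    (hT : 0 < T) (u : E × ℝ → ℝ≥0∞) :
    ¬ IsLocalIntegralSolution α f (initialValue β R) T u := by
  intro hu
  obtain ⟨c, hc, δ, hδ, hK⟩ := exists_le_heatKernel hn hα
  obtain ⟨C₁, hC₁, hS⟩ := exists_le_semigroup_initialValue (R := R) hβ hR hδ hc hn hK
  have hw : 0 < volume.real (Metric.ball (0 : E) 1) :=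
    ENNReal.toReal_pos (Metric.measure_ball_pos _ _ one_pos).ne' measure_ball_lt_top.ne
  set w := volume.real (Metric.ball (0 : E) 1) with hw_def
  have hae := ae_ae_of_ae_restrict_univ_prod (hu.finite_ae.and hu.equation)
  -- the source term is large near the origin for small times
  have hlow : ∀ᵐ s, s ∈ Ioo 0 T → ∀ i, δ / 2 * s ^ (1 / α) ≤ 1 →
      φ i ≤ C₁ * (δ / 2 * s ^ (1 / α)) ^ (-β) →
      ∀ᵐ y : E, y ∈ Metric.ball (0 : E) (δ / 2 * s ^ (1 / α)) →
        ENNReal.ofReal (C * φ i ^ k) ≤ ENNReal.ofReal (f (u (y, s)).toReal) := by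
    filter_upwards [(ae_restrict_iff' measurableSet_Ioo).1 hae] with s hs hsT i h1 hi
    filter_upwards [hs hsT] with y hy hmem
    refine ENNReal.ofReal_le_ofReal ((hfφ i).trans (hf (hφ0 i).le ENNReal.toReal_nonneg ?_))
    -- Finiteness matters: `toReal` would send `∞` to `0`.
    rw [← ENNReal.ofReal_le_iff_le_toReal hy.1.ne, hy.2]
    exact (ENNReal.ofReal_le_ofReal hi).trans ((hS s hsT.1 h1 y hmem).trans le_self_add)
  obtain ⟨t, ht, htT⟩ : ∃ t, (∀ᵐ x : E, u (x, t) < ∞ ∧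
      u (x, t) = semigroup α t (fun y => ENNReal.ofReal (initialValue β R y)) x +
        ∫⁻ s in Ioo 0 t,
          semigroup α (t - s) (fun y => ENNReal.ofReal (f (u (y, s)).toReal)) x) ∧
      t ∈ Ioo 0 T := by
    have : (ae (volume.restrict (Ioo 0 T))).NeBot := by
      rw [ae_neBot, Ne, Measure.restrict_eq_zero, Real.volume_Ioo]
      simpa using hT
    exact (hae.and (ae_restrict_mem measurableSet_Ioo)).exists
  have ht0 : 0 < t := htT.1
  -- For `s ≤ t/2` the kernel bound at time `t - s` holds within distance `D`; `x` and the source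
  -- ball each use up `D/2`.
  set D := δ * (t / 2) ^ (1 / α) with hD
  have hD0 : 0 < D := by positivity
  obtain ⟨x, ⟨hfin, heq⟩, hx⟩ : ∃ x : E, (u (x, t) < ∞ ∧
      u (x, t) = semigroup α t (fun y => ENNReal.ofReal (initialValue β R y)) x +
        ∫⁻ s in Ioo 0 t,
          semigroup α (t - s) (fun y => ENNReal.ofReal (f (u (y, s)).toReal)) x) ∧
      x ∈ Metric.ball (0 : E) (D / 2) := by
    have : (ae ((volume : Measure E).restrict (Metric.ball 0 (D / 2)))).NeBot := by
      rw [ae_neBot, Ne, Measure.restrict_eq_zero]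
      exact (Metric.measure_ball_pos _ _ (by positivity)).ne'
    exact ((ae_restrict_of_ae ht).and (ae_restrict_mem measurableSet_ball)).exists
  rw [mem_ball_zero_iff] at hx
  -- the radius and the time at which the linear evolution reaches the level `φ i`
  set ρ : ℕ → ℝ := fun i => (φ i / C₁) ^ (-(1 / β)) with hρ
  have hρ0 : ∀ i, 0 < ρ i := fun i => Real.rpow_pos_of_pos (div_pos (hφ0 i) hC₁) _
  set σ : ℕ → ℝ := fun i => (2 / δ * ρ i) ^ α with hσ
  have hσ0 : ∀ i, 0 < σ i := fun i => Real.rpow_pos_of_pos (mul_pos (by positivity) (hρ0 i)) _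
  have hσρ : ∀ i, δ / 2 * σ i ^ (1 / α) = ρ i := fun i => by
    have := hρ0 i
    rw [hσ, ← Real.rpow_mul (by positivity), mul_one_div_cancel hα.ne', Real.rpow_one]
    field_simp
  have hρφ : ∀ i, C₁ * ρ i ^ (-β) = φ i := fun i => by
    rw [hρ, ← Real.rpow_mul (div_pos (hφ0 i) hC₁).le, neg_mul_neg, one_div_mul_cancel hβ.ne',
      Real.rpow_one]
    field_simp
  have hρlim : Filter.Tendsto ρ Filter.atTop (nhds 0) :=
    (tendsto_rpow_neg_atTop (by positivity)).comp (hφ.atTop_div_const hC₁)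
  have hσlim : Filter.Tendsto σ Filter.atTop (nhds 0) := by
    have := (hρlim.const_mul (2 / δ)).rpow_const (p := α) (Or.inr hα.le)
    simpa [Real.zero_rpow hα.ne'] using this
  -- Product of the kernel bound (using `t - s ≤ t`), the source constant, the ball volume at `s =
  -- σ_i/2`, and the half from the interval length `σ_i/2`.
  set M : ℝ := c * (t ^ (-(1 / α))) ^ n * C * ((δ / 2) ^ n * w) * (2⁻¹ ^ (1 / α)) ^ n / 2 with hM
  have hM0 : 0 < M := by positivity
  have hbound : ∀ᶠ i in Filter.atTop,
      ENNReal.ofReal (M * (φ i ^ k * (σ i * (σ i ^ (1 / α)) ^ n))) ≤ u (x, t) := by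
    filter_upwards [hρlim.eventually (eventually_le_nhds one_pos),
      hσlim.eventually (eventually_le_nhds (half_pos ht0))] with i hi1 hi2
    rw [heq]
    refine le_trans ?_ le_add_self
    have hsub : Ioo (σ i / 2) (σ i) ⊆ Ioo 0 t := fun s hs =>
      ⟨(half_pos (hσ0 i)).trans hs.1, by linarith [hs.2]⟩
    refine le_trans ?_ (lintegral_mono_set hsub)
    have hconst : ENNReal.ofReal (M * (φ i ^ k * (σ i * (σ i ^ (1 / α)) ^ n))) =
        ∫⁻ _ in Ioo (σ i / 2) (σ i), ENNReal.ofReal (c * (t ^ (-(1 / α))) ^ n * (C * φ i ^ k) *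
          ((δ / 2 * (σ i / 2) ^ (1 / α)) ^ n * w)) := by
      have := hφ0 i
      have := hσ0 i
      rw [setLIntegral_const, Real.volume_Ioo, ← ENNReal.ofReal_mul (by positivity), hM,
        div_eq_mul_inv (σ i) 2, Real.mul_rpow (by positivity) (by positivity), mul_pow, mul_pow]
      congr 1
      ring
    rw [hconst]
    refine lintegral_mono_ae ((ae_restrict_iff' measurableSet_Ioo).2 ?_)
    filter_upwards [hlow] with s hs hsσ
    have hs0 : 0 < s := (half_pos (hσ0 i)).trans hsσ.1
    have hst : s < t := (hsub hsσ).2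
    have hsr : δ / 2 * s ^ (1 / α) ≤ ρ i := by
      rw [← hσρ i]
      have := Real.rpow_le_rpow hs0.le hsσ.2.le (by positivity : 0 ≤ 1 / α)
      gcongr
    have hs0' : 0 < δ / 2 * s ^ (1 / α) := by positivity
    have hg := hs ⟨hs0, hst.trans htT.2⟩ i (hsr.trans hi1) (by
      rw [← hρφ i]
      exact mul_le_mul_of_nonneg_left
        (Real.rpow_le_rpow_of_nonpos hs0' hsr (by linarith)) hC₁.le)
    have hCφ : 0 ≤ C * φ i ^ k := mul_nonneg hC.le (Real.rpow_nonneg (hφ0 i).le _)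
    refine le_trans (ENNReal.ofReal_le_ofReal ?_)
      (le_semigroup (a := c * (t ^ (-(1 / α))) ^ n) hCφ hs0' (fun y hy => ?_) hg)
    · have h1 := Real.rpow_le_rpow (half_pos (hσ0 i)).le hsσ.1.le (by positivity : 0 ≤ 1 / α)
      have := Real.rpow_nonneg (half_pos (hσ0 i)).le (1 / α)
      gcongr
    · have hts : 0 < t - s := sub_pos.2 hst
      refine le_trans ?_ (hK (t - s) hts x y ?_)
      · have := Real.rpow_le_rpow_of_nonpos hts (by linarith : t - s ≤ t)
          (by simpa using hα.le : -(1 / α) ≤ 0)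
        gcongr
      · rw [mem_ball_zero_iff] at hy
        have h1 := norm_sub_le x y
        have h2 : s ^ (1 / α) ≤ (t / 2) ^ (1 / α) :=
          Real.rpow_le_rpow hs0.le (by linarith [hsσ.2]) (by positivity)
        have h3 : (t / 2) ^ (1 / α) ≤ (t - s) ^ (1 / α) :=
          Real.rpow_le_rpow (by positivity) (by linarith [hsσ.2]) (by positivity)
        have h4 := mul_le_mul_of_nonneg_left h2 hδ.le
        have h5 := mul_le_mul_of_nonneg_left h3 hδ.le
        rw [hD] at hx
        linarith
  have hlim : Filter.Tendsto (fun i => M * (φ i ^ k * (σ i * (σ i ^ (1 / α)) ^ n)))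
      Filter.atTop Filter.atTop := by
    -- Since `σ ~ ρ^α` and `ρ ~ φ^(-1/β)`, the factor `σ^(1+n/α)` is of order `φ^(-(n+α)/β)`.
    have he : ∀ i, φ i ^ k * (σ i * (σ i ^ (1 / α)) ^ n) =
        ((2 / δ) ^ (n + α) * (C₁⁻¹) ^ (-((n + α) / β))) * φ i ^ (k - (n + α) / β) := by
      intro i
      have h1 := hφ0 i
      have h2 := hρ0 i
      have h3 : 0 < 2 / δ * ρ i := by positivity
      rw [hσ]
      simp only
      rw [← Real.rpow_mul h3.le, mul_one_div_cancel hα.ne', Real.rpow_one, ← Real.rpow_natCast,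
        ← Real.rpow_add h3, Real.mul_rpow (by positivity) h2.le, hρ]
      simp only
      rw [← Real.rpow_mul (by positivity), div_eq_mul_inv (φ i),
        Real.mul_rpow h1.le (by positivity), sub_eq_add_neg, Real.rpow_add h1]
      have e1 : -(1 / β) * (α + n) = -((n + α) / β) := by ring
      rw [e1, add_comm α]
      ring
    simp only [he]
    refine Filter.Tendsto.const_mul_atTop hM0 (Filter.Tendsto.const_mul_atTop (by positivity) ?_)
    exact (tendsto_rpow_atTop (sub_pos.2 hk)).comp hφ
  have htop := (ENNReal.tendsto_ofReal_atTop.comp hlim)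
  exact absurd (top_unique (le_of_tendsto htop hbound)) hfin.ne

end Nonexistence

end FracHeat

end

theorem mainTheorem1 (n : ℕ) (hn : 0 < n) (α q k φ₀ : ℝ)
    (hα : α ∈ Set.Ioc (1 : ℝ) 2) (hq : 1 ≤ q) (hk : q * (1 + α / n) < k)
    (hφ₀ : α ^ (1 / (k - 1)) < φ₀) :
    FracHeat.IsSource (FracHeat.source α k φ₀) ∧
    FracHeat.Osgood (FracHeat.source α k φ₀) ∧
    (Set.Ioo ((n + α) / k) (n / q)).Nonempty ∧
    ∀ β ∈ Set.Ioo ((n + α) / k) (n / q), ∀ R : ℝ, 1 < R →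
      (∀ x : EuclideanSpace ℝ (Fin n), 0 ≤ FracHeat.initialValue β R x) ∧
      MemLp (FracHeat.initialValue β R : EuclideanSpace ℝ (Fin n) → ℝ)
        (ENNReal.ofReal q) volume ∧
      ¬ ∃ T : ℝ, 0 < T ∧ ∃ u : EuclideanSpace ℝ (Fin n) × ℝ → ℝ≥0∞,
        FracHeat.IsLocalIntegralSolution α (FracHeat.source α k φ₀)
          (FracHeat.initialValue β R) T u ∧
        ∀ᵐ t ∂(volume.restrict (Set.Ico 0 T)), FracHeat.MemL1Loc (fun x => u (x, t)) := by
  have hα1 : 1 < α := hα.1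
  have hα0 : 0 < α := by linarith
  have hn' : (0 : ℝ) < n := Nat.cast_pos.2 hn
  have hαn : 0 < α / n := by positivity
  have hk1 : 1 < k := by nlinarith
  have hk0 : 0 < k := by linarith
  have hk1' : 0 < k - 1 := by linarith
  have h1 : 1 < φ₀ := (Real.one_lt_rpow hα1 (by positivity)).trans hφ₀
  have hαφ : α < φ₀ ^ (k - 1) := by
    have := Real.rpow_lt_rpow (by positivity) hφ₀ hk1'
    rwa [← Real.rpow_mul hα0.le, one_div_mul_cancel hk1'.ne', Real.rpow_one] at this
  have hsrc := FracHeat.isSource_source hα1 hk1 h1 hαφ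
  refine ⟨hsrc, FracHeat.osgood_source hα1 hk1 h1 hαφ, ?_, ?_⟩
  · rw [Set.nonempty_Ioo, div_lt_div_iff₀ hk0 (by linarith)]
    have e : (n + α) * q = n * (q * (1 + α / n)) := by field_simp
    rw [e]
    exact mul_lt_mul_of_pos_left hk hn'
  · intro β hβ R hR
    have hβ0 : 0 < β := lt_trans (by positivity) hβ.1
    refine ⟨FracHeat.initialValue_nonneg β R, FracHeat.memLp_initialValue hn (by linarith)
      ((lt_div_iff₀ (by linarith)).1 hβ.2) R, ?_⟩
    rintro ⟨T, hT, u, hu, -⟩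
    refine FracHeat.not_isLocalIntegralSolution hn hα0 hβ0 hR ?_ (FracHeat.one_sub_rpow_pos hk1 h1)
      hsrc.monotone (FracHeat.phi_pos hk1 h1) (FracHeat.tendsto_phi hk1 h1)
      (FracHeat.mul_rpow_le_source_phi hα1 hk1 h1 hαφ) hT u hu
    rw [div_lt_iff₀ hβ0, mul_comm]
    exact (div_lt_iff₀ hk0).1 hβ.1
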